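/- Setting. Let $m,n\in\mathbb N$, let $M_1,\dots,M_m:[0,\infty)\to\mathbb R$ be nondecreasing concave functions with $M_i(0)=0$, continuous on $[0,\infty)$ and continuously differentiable on $(0,\infty)$, and let $b_{ij}\in[0,1]$ $(1\le i\le m,\ 1\le j\le n)$ be in general position: for every vector $p\ge 0$, $p\ne 0$, in $\mathbb R^m$, at most $m$ of the sets $\operatorname{argmax}_i b_{ij}p_i$, $j=1,\dots,n$, are not singletons. Let $\mathrm{OPT}$ be the maximum of $\sum_i M_i\bigl(\sum_{j=1}^n b_{ij}x_{ij}\bigr)$ over $x_{ij}\ge 0$ with $\sum_i x_{ij}\le 1$ for all $j$. The items $1,\dots,n$ arrive in a uniformly random order $\sigma$ (the $j$-th arrival is the item $\sigma(j)$ and reveals $b_{i\sigma(j)}$, $1\le i\le m$). A method that makes the decisions $x_{ij}(\sigma)$ on the $j$-th arrival is $c$-competitive on this instance if $\mathbb E_\sigma\bigl[\sum_i M_i\bigl(\sum_j b_{i\sigma(j)}x_{ij}(\sigma)\bigr)\bigr]\ge c\cdot\mathrm{OPT}$. The One-Time Learning Algorithm (OLA) with sample fraction $\delta$ uses a sample of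 size $s$, where $s$ is $\delta n$ rounded to an integer, up or down ($|s-\delta n|<1$). It allocates nothing during the first $s$ arrivals. It then takes an optimal solution $(\hat x,\hat u)$ of the partial problem $P_\delta$: maximize $\sum_i M_i(u_i)$ subject to $\sum_{j\le s}\frac{b_{i\sigma(j)}}{\delta}x_{ij}=u_i$ for all $i$, $\sum_i x_{ij}\le 1$ for all $j\le s$, $x_{ij}\ge 0$. Each later arrival $j>s$ is allocated entirely to one $i\in\operatorname{argmax}_k b_{k\sigma(j)}M_k'(\hat u_k)$. The choice of the optimal solution and the breaking of ties are arbitrary. Proposition. For every $\kappa\in(0,1)$ there is a constant $C>0$, depending only on $\kappa$, such that the following holds for every $\varepsilon\in(0,1/2)$ and all $m$, $n$, $M$, $b$ as above. Let the OLA be run with sample fraction $\delta=\kappa\varepsilon$, and suppose that its solution $\hat u$ of $P_{\delta}$ satisfies $$\min_i \hat u_i\ \ge\ C\,\frac{m\log(m^2n/\varepsilon)}{\varepsilon^3}\qquad\text{and}\qquad M_i'(\hat u_i)\ne 0\ \text{ for at least one } i .$$ Then the OLA is $(1-\varepsilon)$-competitive. More generally, if these two conditions on $\hat u$ hold with probability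 at least $1-\eta$ over the arrival order, where $\eta\ge 0$, then the OLA is $(1-\varepsilon-\eta)$-competitive. -/

import Mathlib

namespace OnlineMatching

noncomputable section

/-- A return function on `[0, ∞)`: it vanishes at `0`, is nondecreasing and concave on `[0, ∞)`,
continuous there and continuously differentiable on `(0, ∞)`. Its values at negative arguments
are irrelevant. The slope at `0` may be infinite, as for `t ↦ t ^ p` with `0 < p < 1`. -/
structure IsReturn (f : ℝ → ℝ) : Prop where
  zero : f 0 = 0
  mono : MonotoneOn f (Set.Ici 0)
  concave : ConcaveOn ℝ (Set.Ici 0) f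
  cont : ContinuousOn f (Set.Ici 0)
  smooth : ContDiffOn ℝ 1 f (Set.Ioi 0)

/-- The marginal return `f'(w)` for `w ≥ 0` (one-sided at `w = 0`). -/
def slope (f : ℝ → ℝ) (w : ℝ) : ℝ := derivWithin f (Set.Ici 0) w

/-- The total gain `∑ i, M i (u i)`. -/
def gain {m : ℕ} (M : Fin m → ℝ → ℝ) (u : Fin m → ℝ) : ℝ := ∑ i, M i (u i)

/-- `(x, u)` is feasible for the matching problem with weights `b`: `x i j` is the fraction of the
item `j` that is matched to `i`, and `u i` is the value matched to `i`. -/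
structure IsFeasible {m : ℕ} {J : Type*} [Fintype J] (b x : Fin m → J → ℝ) (u : Fin m → ℝ) :
    Prop where
  value : ∀ i, ∑ j, b i j * x i j = u i
  le_one : ∀ j, ∑ i, x i j ≤ 1
  nonneg : ∀ i j, 0 ≤ x i j

/-- `(x, u)` is an optimal solution of the matching problem with weights `b` and returns `M`. -/
def IsOptimal {m : ℕ} {J : Type*} [Fintype J] (M : Fin m → ℝ → ℝ) (b x : Fin m → J → ℝ)
    (u : Fin m → ℝ) : Prop :=
  IsFeasible b x u ∧ ∀ x' u', IsFeasible b x' u' → gain M u' ≤ gain M u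

/-- The optimal value of the offline problem. -/
def opt {m : ℕ} {J : Type*} [Fintype J] (M : Fin m → ℝ → ℝ) (b : Fin m → J → ℝ) : ℝ :=
  sSup {v | ∃ x u, IsFeasible b x u ∧ v = gain M u}

/-- The index `i` belongs to `argmax_k q k * p k`. -/
def IsArgmax {m : ℕ} (q p : Fin m → ℝ) (i : Fin m) : Prop := ∀ k, q k * p k ≤ q i * p i

/-- General position: for every nonzero price vector `p ≥ 0`, at most `m` of the sets
`argmax_i b i j * p i` fail to be singletons. -/
def GeneralPosition {m n : ℕ} (b : Fin m → Fin n → ℝ) : Prop :=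
  ∀ p : Fin m → ℝ, (∀ i, 0 ≤ p i) → p ≠ 0 →
    {j : Fin n | ¬ ∃! i, IsArgmax (fun k => b k j) p i}.ncard ≤ m

/-- The weights of the partial problem with sample fraction `δ`: those of the first `s` arrivals,
divided by `δ`. Here `a i j` is the weight of the `j`-th arrival. -/
def sampleWeights {m n : ℕ} (δ : ℝ) (s : ℕ) (a : Fin m → Fin n → ℝ) :
    Fin m → {j : Fin n // (j : ℕ) < s} → ℝ :=
  fun i j => a i j.1 / δ

/-- `x` is the decision matrix of an execution of the one-time learning algorithm with sample
fraction `δ` and sample size `s` on the arrival sequence with weights `a`, in which the solution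
found for the partial problem has the value vector `u`. Nothing is allocated during the first `s`
arrivals; afterwards each arrival `j` is allocated entirely to one index in
`argmax_i a i j * M i '(u i)`. Which optimal solution is found and how ties are broken is left
open. -/
structure IsOLARun {m n : ℕ} (M : Fin m → ℝ → ℝ) (δ : ℝ) (s : ℕ) (a : Fin m → Fin n → ℝ)
    (u : Fin m → ℝ) (x : Fin m → Fin n → ℝ) : Prop where
  learn : ∃ xhat, IsOptimal M (sampleWeights δ s a) xhat u
  explore : ∀ i (j : Fin n), (j : ℕ) < s → x i j = 0
  exploit : ∀ j : Fin n, s ≤ (j : ℕ) →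
    ∃ k, IsArgmax (fun i => a i j) (fun i => slope (M i) (u i)) k ∧
      ∀ i, x i j = if i = k then 1 else 0

/-- The weights in arrival order: the `j`-th arrival is the item `σ j`. -/
def arrivals {m n : ℕ} (b : Fin m → Fin n → ℝ) (σ : Equiv.Perm (Fin n)) : Fin m → Fin n → ℝ :=
  fun i j => b i (σ j)

/-- Probability of an event under a uniformly random arrival order. -/
def orderProb {n : ℕ} (A : Set (Equiv.Perm (Fin n))) : ℝ :=
  (A.ncard : ℝ) / (n.factorial : ℝ)

/-- Expectation under a uniformly random arrival order. -/
def orderMean {n : ℕ} (f : Equiv.Perm (Fin n) → ℝ) : ℝ :=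
  (∑ σ, f σ) / (n.factorial : ℝ)

/-- `c`-competitiveness in the random permutation model on the instance `(M, b)`. Here `x σ i j` is
the decision on the `j`-th arrival when the items arrive in the order `σ`. -/
def IsCompetitive {m n : ℕ} (M : Fin m → ℝ → ℝ) (b : Fin m → Fin n → ℝ) (c : ℝ)
    (x : Equiv.Perm (Fin n) → Fin m → Fin n → ℝ) : Prop :=
  c * opt M b ≤ orderMean fun σ => gain M fun i => ∑ j, arrivals b σ i j * x σ i j

end

end OnlineMatching

namespace OnlineMatching

open Finset

/-! ### Sampling without replacement -/

/-! Put `p i = slope (M i) (u i)`, where `u` solves the partial problem. First-order optimality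
gives every sampled item with a unique maximizer of `b k j * p k` to that maximizer
(`IsOptimal.mul_eq_clearValue`). General position leaves at most `m` other items, so `δ * u i` is
the sampled sum of `clearValue b p i` up to `m`.

For fixed `p` this sum concentrates around `δ` times the total over all items: Maclaurin's
inequality compares sampling without replacement to independent sampling, and a Chernoff bound
follows. The prices depend on the sample, however, so a bound uniform in `p` is needed. Clear values
depend on `p` only through the signs of `m * m * n` linear forms on `ℝ ^ m`; by Sauer–Shelah these
have at most `(m ^ 2 * n + 1) ^ m` patterns, and a union bound applies.

On a typical order, `u i` thus predicts the total clear value up to a factor `1 ± 4 * τ`. The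
algorithm collects at least `(1 - δ - 5 * τ) * u i` for each `i`, hence by concavity that fraction
of `gain M u`, while weak duality at the prices `p` gives `opt ≤ (1 + 5 * τ) * gain M u`. With `τ =
(1 - κ) * ε / 20` the loss `δ + 10 * τ` and the failure probability `(1 - κ) * ε / 2` add up to `ε`.
-/

theorem sum_powersetCard_succ {α : Type*} [DecidableEq α] (z : α → ℝ) (s : ℕ) (T : Finset α) :
    ((s : ℝ) + 1) * ∑ S ∈ T.powersetCard (s + 1), ∏ j ∈ S, z j =
      ∑ x ∈ T, z x * ∑ S ∈ (T.erase x).powersetCard s, ∏ j ∈ S, z j := by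
  have h1 : ((s : ℝ) + 1) * ∑ S ∈ T.powersetCard (s + 1), ∏ j ∈ S, z j =
      ∑ S ∈ T.powersetCard (s + 1), ∑ _x ∈ S, ∏ j ∈ S, z j := by
    rw [mul_sum]
    refine sum_congr rfl fun S hS => ?_
    rw [sum_const, (mem_powersetCard.1 hS).2, nsmul_eq_mul]
    push_cast
    ring
  rw [h1]
  simp_rw [mul_sum]
  rw [sum_sigma', sum_sigma']
  refine sum_bij' (fun p _ => ⟨p.2, p.1.erase p.2⟩) (fun p _ => ⟨insert p.1 p.2, p.1⟩)
    ?_ ?_ ?_ ?_ ?_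
  · rintro ⟨S, x⟩ h
    simp only [mem_sigma, mem_powersetCard] at h ⊢
    obtain ⟨⟨hS, hc⟩, hx⟩ := h
    exact ⟨hS hx, erase_subset_erase _ hS, by rw [card_erase_of_mem hx, hc]; rfl⟩
  · rintro ⟨x, S⟩ h
    simp only [mem_sigma, mem_powersetCard] at h ⊢
    obtain ⟨hx, hS, hc⟩ := h
    have hxS : x ∉ S := fun h => notMem_erase x T (hS h)
    refine ⟨⟨insert_subset hx (hS.trans (erase_subset _ _)), ?_⟩, mem_insert_self _ _⟩
    rw [card_insert_of_notMem hxS, hc]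
  · rintro ⟨S, x⟩ h
    simp only [mem_sigma, mem_powersetCard] at h
    simp [insert_erase h.2]
  · rintro ⟨x, S⟩ h
    simp only [mem_sigma, mem_powersetCard] at h
    have hxS : x ∉ S := fun h' => notMem_erase x T (h.2.1 h')
    simp [erase_insert hxS]
  · rintro ⟨S, x⟩ h
    simp only [mem_sigma, mem_powersetCard] at h
    exact (mul_prod_erase S z h.2).symm

/-- The right side is the tangent of the left side at `r = 0`. In the induction step the error is
`(N - s) * r ^ 2 ≥ 0`. -/
theorem one_add_mul_one_sub_pow_le {N r : ℝ} (hr : r ≤ 1) (s : ℕ) (hs : (s : ℝ) ≤ N) :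
    (1 + N * r) * (1 - r) ^ s ≤ 1 + (N - s) * r := by
  induction s with
  | zero => simp
  | succ s ih =>
    push_cast at hs ⊢
    have h := mul_le_mul_of_nonneg_right (ih (by linarith)) (sub_nonneg.2 hr)
    rw [pow_succ, ← mul_assoc]
    nlinarith [mul_nonneg (show 0 ≤ N - s by linarith) (sq_nonneg r)]

/-- Maclaurin's inequality between the first and the `s`-th elementary symmetric mean. -/
theorem sum_powersetCard_prod_le {α : Type*} [DecidableEq α] (z : α → ℝ) (hz : ∀ x, 0 ≤ z x)
    (s : ℕ) (T : Finset α) :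
    ∑ S ∈ T.powersetCard s, ∏ j ∈ S, z j ≤ (#T).choose s * ((∑ x ∈ T, z x) / #T) ^ s := by
  induction s generalizing T with
  | zero => simp
  | succ s ih =>
    rcases lt_or_ge #T (s + 1) with hT | hT
    · simp [powersetCard_eq_empty.2 hT, Nat.choose_eq_zero_of_lt hT]
    have hs1 : (0 : ℝ) < (s : ℝ) + 1 := by positivity
    have hN0 : (0 : ℝ) < #T := by exact_mod_cast (by omega : 0 < #T)
    refine le_of_mul_le_mul_left ?_ hs1
    rw [sum_powersetCard_succ]
    have hch : ((s : ℝ) + 1) * ((#T).choose (s + 1)) = #T * ((#T - 1).choose s) := by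
      obtain ⟨k, hk⟩ := Nat.exists_eq_succ_of_ne_zero (by omega : #T ≠ 0)
      rw [hk]
      have := Nat.add_one_mul_choose_eq k s
      simp only [Nat.succ_eq_add_one, Nat.add_sub_cancel]
      have h2 : ((k + 1 : ℕ) : ℝ) * (k.choose s) = ((k + 1).choose (s + 1)) * ((s + 1 : ℕ) : ℝ) := by
        exact_mod_cast this
      rw [h2]; push_cast; ring
    rw [← mul_assoc, hch]
    set Z := ∑ x ∈ T, z x with hZ
    have hZ0 : 0 ≤ Z := sum_nonneg fun x _ => hz x
    have hstep : ∀ x ∈ T, z x * ∑ S ∈ (T.erase x).powersetCard s, ∏ j ∈ S, z j ≤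
        (#T - 1).choose s * (z x * ((Z - z x) / (#T - 1 : ℕ)) ^ s) := by
      intro x hx
      have h := mul_le_mul_of_nonneg_left (ih (T.erase x)) (hz x)
      rw [card_erase_of_mem hx, show ∑ y ∈ T.erase x, z y = Z - z x by
        rw [hZ, ← add_sum_erase T z hx]; ring] at h
      linarith
    refine (sum_le_sum hstep).trans ?_
    rw [← mul_sum, mul_comm (#T : ℝ), mul_assoc]
    refine mul_le_mul_of_nonneg_left ?_ (Nat.cast_nonneg _)
    -- For `s = 0` the set may be a singleton, and `#T - 1` cannot be a denominator.
    rcases eq_or_ne s 0 with rfl | hs0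
    · simp only [pow_zero, mul_one, zero_add, pow_one]
      rw [mul_div_cancel₀ _ hN0.ne']
    rcases hZ0.eq_or_lt with hZ0 | hZ0
    · have : ∀ x ∈ T, z x = 0 := (sum_eq_zero_iff_of_nonneg fun x _ => hz x).1 hZ0.symm
      rw [sum_eq_zero fun x hx => by rw [this x hx, zero_mul]]
      positivity
    have hN1 : (0 : ℝ) < (#T - 1 : ℕ) := by exact_mod_cast (by omega : 0 < #T - 1)
    have hNc : ((#T - 1 : ℕ) : ℝ) = (#T : ℝ) - 1 := by
      rw [Nat.cast_sub (by omega)]; simp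
    set N : ℝ := ((#T - 1 : ℕ) : ℝ) with hN
    set c : ℝ := Z / #T with hc
    have hc0 : 0 < c := by positivity
    have hZc : Z = c * (N + 1) := by rw [hc, hNc]; field_simp; ring
    have hsN : (s : ℝ) ≤ N := by rw [hN]; exact_mod_cast (by omega : s ≤ #T - 1)
    -- Tangent line at the mean `z x = c`; its linear part sums to zero over `T`.
    have hpt : ∀ x ∈ T, z x * ((Z - z x) / N) ^ s ≤
        c ^ (s + 1) * (1 + (N - s) * ((z x / c - 1) / N)) := by
      intro x hx
      have hzx : z x ≤ Z := single_le_sum (fun y _ => hz y) hx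
      have hr : (z x / c - 1) / N ≤ 1 := by
        rw [div_le_one hN1, sub_le_iff_le_add, div_le_iff₀ hc0]
        linarith
      have h := one_add_mul_one_sub_pow_le hr s hsN
      have e1 : (1 + N * ((z x / c - 1) / N)) = z x / c := by field_simp; ring
      have e2 : 1 - (z x / c - 1) / N = ((Z - z x) / N) / c := by
        rw [hZc]; field_simp; ring
      rw [e1, e2, div_pow] at h
      have h' := mul_le_mul_of_nonneg_left h (pow_pos hc0 (s + 1)).le
      refine le_trans (le_of_eq ?_) h'
      field_simp
      ring
    refine (sum_le_sum hpt).trans (le_of_eq ?_)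
    rw [← mul_sum, sum_add_distrib, ← mul_sum, ← sum_div, sum_sub_distrib, ← sum_div, ← hZ]
    simp only [sum_const, nsmul_eq_mul, mul_one]
    have : Z / c - #T = 0 := by rw [hc]; field_simp; ring
    rw [this]
    ring

/-- The inverse of `σ` numbers the items by arrival time, and the condition says that `S` is a
prefix of this numbering. -/
theorem card_perm_map_prefix_eq {n : ℕ} (S : Finset (Fin n)) :
    #{σ : Equiv.Perm (Fin n) | (univ.filter fun j : Fin n => (j : ℕ) < #S).map σ.toEmbedding = S} =
      (#S).factorial * (n - #S).factorial := by
  have h := Numbering.card_prefixed S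
  rw [Fintype.card_fin] at h
  rw [← h]
  refine card_bij' (fun σ _ => σ.symm.trans (finCongr (Fintype.card_fin n).symm))
    (fun f _ => (f.trans (finCongr (Fintype.card_fin n))).symm) ?_ ?_ ?_ ?_
  · intro σ hσ
    simp only [mem_filter, mem_univ, true_and] at hσ
    rw [Numbering.mem_prefixed]
    intro x
    conv_lhs => rw [← hσ]
    simp [mem_map_equiv]
  · intro f hf
    rw [Numbering.mem_prefixed] at hf
    simp only [mem_filter, mem_univ, true_and]
    ext x
    rw [hf x]
    simp only [mem_map, mem_filter, mem_univ, true_and]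
    constructor
    · rintro ⟨a, ha, rfl⟩
      simpa using ha
    · intro h
      exact ⟨finCongr (Fintype.card_fin n) (f x), by simpa using h, by simp⟩
  · intro σ _
    ext x
    simp
  · intro f _
    ext x
    simp

/-- Grouping the orders by the set of the first `s` arrivals turns the average into an elementary
symmetric mean, to which Maclaurin's inequality applies. -/
theorem sum_perm_prod_prefix_le {n s : ℕ} (hs : s ≤ n) (z : Fin n → ℝ) (hz : ∀ j, 0 ≤ z j) :
    ∑ σ : Equiv.Perm (Fin n), ∏ j with (j : Fin n).val < s, z (σ j) ≤
      n.factorial * ((∑ j, z j) / n) ^ s := by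
  have hcard : #(univ.filter fun j : Fin n => (j : ℕ) < s) = s := by
    rw [Fin.card_filter_val_lt]; simpa using hs
  have h1 : ∑ σ : Equiv.Perm (Fin n), ∏ j with (j : Fin n).val < s, z (σ j) =
      ∑ S ∈ (univ : Finset (Fin n)).powersetCard s,
        ((s.factorial * (n - s).factorial : ℕ) : ℝ) * ∏ j ∈ S, z j := by
    rw [← sum_fiberwise_of_maps_to (s := univ) (t := (univ : Finset (Fin n)).powersetCard s)
      (g := fun σ : Equiv.Perm (Fin n) =>
        (univ.filter fun j : Fin n => (j : ℕ) < s).map σ.toEmbedding)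
      (fun σ _ => mem_powersetCard.2 ⟨subset_univ _, by rw [card_map, hcard]⟩)]
    refine sum_congr rfl fun S hS => ?_
    have hSs := (mem_powersetCard.1 hS).2
    have h := card_perm_map_prefix_eq S
    rw [hSs] at h
    rw [← h, ← nsmul_eq_mul, ← sum_const]
    refine sum_congr rfl fun σ hσ => ?_
    simp only [mem_filter, mem_univ, true_and] at hσ
    rw [← hσ, prod_map]
    rfl
  rw [h1, ← mul_sum]
  have h2 := sum_powersetCard_prod_le z hz s univ
  rw [card_univ, Fintype.card_fin] at h2
  refine (mul_le_mul_of_nonneg_left h2 (Nat.cast_nonneg _)).trans (le_of_eq ?_)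
  rw [← mul_assoc]
  congr 1
  have := Nat.choose_mul_factorial_mul_factorial hs
  rw [← this]; push_cast; ring

theorem sum_perm_exp_prefix_le {n s : ℕ} (hs : s ≤ n) (hn : 0 < n) (a : Fin n → ℝ)
    (ha : ∀ j, a j ∈ Set.Icc (0 : ℝ) 1) {t : ℝ} (ht : |t| ≤ 1) :
    ∑ σ : Equiv.Perm (Fin n), Real.exp (t * ∑ j with (j : Fin n).val < s, a (σ j)) ≤
      n.factorial * Real.exp (s * (∑ j, a j) / n * (t + t ^ 2)) := by
  have h := sum_perm_prod_prefix_le hs (fun j => Real.exp (t * a j)) fun j => (Real.exp_pos _).le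
  simp_rw [← Real.exp_sum, ← mul_sum] at h
  refine h.trans (mul_le_mul_of_nonneg_left ?_ (Nat.cast_nonneg _))
  have hn' : (0 : ℝ) < n := by exact_mod_cast hn
  -- Since `a j ^ 2 ≤ a j` on `[0, 1]`, the quadratic term scales with the mean, which yields a
  -- relative deviation bound.
  have hb : ∀ j, Real.exp (t * a j) ≤ 1 + (t + t ^ 2) * a j := by
    intro j
    obtain ⟨h0, h1⟩ := ha j
    have hle : |t * a j| ≤ 1 := by
      rw [abs_mul, abs_of_nonneg h0]
      exact mul_le_one₀ ht h0 h1
    have := (abs_le.1 (Real.abs_exp_sub_one_sub_id_le hle)).2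
    nlinarith [mul_nonneg (sq_nonneg t) (mul_nonneg h0 (sub_nonneg.2 h1))]
  have hmean : (∑ j, Real.exp (t * a j)) / n ≤ Real.exp ((t + t ^ 2) * (∑ j, a j) / n) := by
    have : (∑ j, Real.exp (t * a j)) ≤ n + (t + t ^ 2) * ∑ j, a j := by
      refine (sum_le_sum fun j _ => hb j).trans (le_of_eq ?_)
      rw [sum_add_distrib, ← mul_sum]; simp
    calc _ ≤ (n + (t + t ^ 2) * ∑ j, a j) / n := by gcongr
      _ = (t + t ^ 2) * (∑ j, a j) / n + 1 := by field_simp; ring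
      _ ≤ _ := Real.add_one_le_exp _
  refine (pow_le_pow_left₀ (by positivity) hmean s).trans (le_of_eq ?_)
  rw [← Real.exp_nat_mul]
  congr 1
  ring

/-- Concentration of the sum of a random sample drawn without replacement around its mean. -/
theorem card_perm_deviation_le {n s : ℕ} (hs : s ≤ n) (hn : 0 < n) (a : Fin n → ℝ)
    (ha : ∀ j, a j ∈ Set.Icc (0 : ℝ) 1) {τ B : ℝ} (hτ : 0 ≤ τ) (hτ1 : τ ≤ 1) :
    (#{σ : Equiv.Perm (Fin n) | τ * max (s * (∑ j, a j) / n) B <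
        |∑ j with (j : Fin n).val < s, a (σ j) - s * (∑ j, a j) / n|} : ℝ) ≤
      n.factorial * (2 * Real.exp (-(τ ^ 2 * B / 4))) := by
  set μ : ℝ := s * (∑ j, a j) / n with hμ
  have hμ0 : 0 ≤ μ := by
    have : 0 ≤ ∑ j, a j := sum_nonneg fun j _ => (ha j).1
    positivity
  set X : Equiv.Perm (Fin n) → ℝ := fun σ => ∑ j with (j : Fin n).val < s, a (σ j)
  -- At `t = ±τ / 2` the term `t ^ 2 * μ` uses at most half of `τ / 2 * (τ * max μ B)`; at least `τ
  -- ^ 2 * B / 4` remains.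
  have key : ∀ t : ℝ, |t| = τ / 2 → ∑ σ, Real.exp (t * (X σ - μ) - τ / 2 * (τ * max μ B)) ≤
      n.factorial * Real.exp (-(τ ^ 2 * B / 4)) := by
    intro t ht
    have h := sum_perm_exp_prefix_le hs hn a ha (t := t) (by rw [ht]; linarith)
    have e : ∀ σ, Real.exp (t * (X σ - μ) - τ / 2 * (τ * max μ B)) =
        Real.exp (t * X σ) * Real.exp (-(t * μ) - τ / 2 * (τ * max μ B)) := by
      intro σ; rw [← Real.exp_add]; congr 1; ring
    simp_rw [e]
    rw [← sum_mul]
    refine (mul_le_mul_of_nonneg_right h (Real.exp_pos _).le).trans ?_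
    rw [mul_assoc, ← Real.exp_add]
    refine mul_le_mul_of_nonneg_left (Real.exp_le_exp.2 ?_) (Nat.cast_nonneg _)
    have ht2 : t ^ 2 = τ ^ 2 / 4 := by rw [← sq_abs, ht]; ring
    rw [ht2]
    nlinarith [mul_le_mul_of_nonneg_left (le_max_left μ B) (sq_nonneg τ),
      mul_le_mul_of_nonneg_left (le_max_right μ B) (sq_nonneg τ)]
  have k1 := key (τ / 2) (abs_of_nonneg (by linarith))
  have k2 := key (-(τ / 2)) (by rw [abs_neg, abs_of_nonneg (by linarith)])
  rw [← sum_boole]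
  calc _ ≤ ∑ σ : Equiv.Perm (Fin n), (Real.exp (τ / 2 * (X σ - μ) - τ / 2 * (τ * max μ B)) +
        Real.exp (-(τ / 2) * (X σ - μ) - τ / 2 * (τ * max μ B))) := by
        refine sum_le_sum fun σ _ => ?_
        split_ifs with h
        · rcases lt_abs.1 h with h | h
          · have : 1 ≤ Real.exp (τ / 2 * (X σ - μ) - τ / 2 * (τ * max μ B)) :=
              Real.one_le_exp (by nlinarith)
            linarith [Real.exp_pos (-(τ / 2) * (X σ - μ) - τ / 2 * (τ * max μ B))]
          · have : 1 ≤ Real.exp (-(τ / 2) * (X σ - μ) - τ / 2 * (τ * max μ B)) :=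
              Real.one_le_exp (by nlinarith)
            linarith [Real.exp_pos (τ / 2 * (X σ - μ) - τ / 2 * (τ * max μ B))]
        · positivity
    _ ≤ _ := by rw [sum_add_distrib]; linarith

/-! ### The number of price patterns -/

/-- A set shattered by the positivity sets of linear forms on `ℝ ^ m` has at most `m` elements. -/
theorem card_le_of_shatters {m : ℕ} {E : Type*} [DecidableEq E] (v : E → Fin m → ℝ)
    (𝒜 : Finset (Finset E))
    (h𝒜 : ∀ A ∈ 𝒜, ∃ p : Fin m → ℝ, ∀ e, e ∈ A ↔ 0 < ∑ i, v e i * p i)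
    {T : Finset E} (hT : 𝒜.Shatters T) : #T ≤ m := by
  by_contra! hlt
  have hdep : ¬ LinearIndependent ℝ fun e : T => v e := by
    intro h
    have := h.fintype_card_le_finrank
    simp at this
    omega
  obtain ⟨g, hg, e₀, he₀⟩ := Fintype.not_linearIndependent_iff.1 hdep
  -- Shattering provides a `p` whose forms are positive exactly where `g` is. Every term of the
  -- relation evaluated at `p` is then nonnegative and the one at `e₀` is positive, yet the sum is
  -- zero.
  have main : ∀ g : T → ℝ, ∑ e, g e • v e = 0 → ∀ e₀, ¬ 0 < g e₀ := by
    intro g hg e₀ he₀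
    obtain ⟨A, hA, hTA⟩ := hT (t := (univ.filter fun e : T => 0 < g e).map
      (Function.Embedding.subtype _)) (by
        intro e he
        obtain ⟨e', _, rfl⟩ := mem_map.1 he
        exact e'.2)
    obtain ⟨p, hp⟩ := h𝒜 A hA
    have hmem : ∀ e : T, (e : E) ∈ A ↔ 0 < g e := by
      intro e
      have : (e : E) ∈ T ∩ A ↔ 0 < g e := by rw [hTA]; simp
      rw [← this]; simp
    have hsum : ∑ e : T, g e * ∑ i, v e i * p i = 0 := by
      have : ∀ e : T, g e * ∑ i, v e i * p i = ∑ i, (g e • v e) i * p i := by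
        intro e; rw [mul_sum]; simp [mul_assoc]
      simp_rw [this]
      rw [sum_comm]
      simp_rw [← sum_mul, ← Finset.sum_apply, hg]
      simp
    have hnn : ∀ e : T, 0 ≤ g e * ∑ i, v e i * p i := by
      intro e
      by_cases h : 0 < g e
      · exact (mul_pos h ((hp _).1 ((hmem e).2 h))).le
      · have : ¬ 0 < ∑ i, v e i * p i := fun h' => h ((hmem e).1 ((hp _).2 h'))
        exact mul_nonneg_of_nonpos_of_nonpos (not_lt.1 h) (not_lt.1 this)
    have := (sum_eq_zero_iff_of_nonneg fun e _ => hnn e).1 hsum e₀ (mem_univ _)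
    exact (mul_pos he₀ ((hp _).1 ((hmem e₀).2 he₀))).ne' this
  rcases lt_or_gt_of_ne he₀ with h | h
  · refine main (fun e => -g e) ?_ e₀ (by simpa using h)
    simp_rw [neg_smul]
    rw [sum_neg_distrib, hg, neg_zero]
  · exact main g hg e₀ h

theorem card_finset_card_le_le {E : Type*} [Fintype E] [DecidableEq E] (m : ℕ) :
    #{T : Finset E | #T ≤ m} ≤ (Fintype.card E + 1) ^ m := by
  calc _ ≤ #((univ : Finset (Fin m → Option E)).image fun f =>
        univ.filter fun e => ∃ i, f i = some e) := by
        refine card_le_card fun T hT => ?_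
        simp only [mem_filter, mem_univ, true_and] at hT
        rw [mem_image]
        refine ⟨fun i => if h : (i : ℕ) < #T then some (T.equivFin.symm ⟨i, h⟩ : E) else none,
          mem_univ _, ?_⟩
        ext e
        simp only [mem_filter, mem_univ, true_and]
        constructor
        · rintro ⟨i, hi⟩
          split_ifs at hi with h
          rw [← Option.some.inj hi]
          exact (T.equivFin.symm ⟨i, h⟩).2
        · intro he
          refine ⟨⟨T.equivFin ⟨e, he⟩, (T.equivFin ⟨e, he⟩).2.trans_le hT⟩, ?_⟩
          simp
    _ ≤ _ := card_image_le
    _ = _ := by simp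

/-- Sauer–Shelah in Pajor's form: a family has at most as many members as it shatters sets, and here
these sets have at most `m` elements. -/
theorem card_positivity_patterns_le {m : ℕ} {E : Type*} [Fintype E] [DecidableEq E]
    (v : E → Fin m → ℝ) (𝒜 : Finset (Finset E))
    (h𝒜 : ∀ A ∈ 𝒜, ∃ p : Fin m → ℝ, ∀ e, e ∈ A ↔ 0 < ∑ i, v e i * p i) :
    #𝒜 ≤ (Fintype.card E + 1) ^ m := by
  refine 𝒜.card_le_card_shatterer.trans ((card_le_card fun T hT => ?_).trans
    (card_finset_card_le_le m))
  simpa using card_le_of_shatters v 𝒜 h𝒜 (mem_shatterer.1 hT)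

/-! ### Return functions -/

theorem IsReturn.nonneg {f : ℝ → ℝ} (hf : IsReturn f) {w : ℝ} (hw : 0 ≤ w) : 0 ≤ f w := by
  have := hf.mono (Set.mem_Ici.2 le_rfl) (Set.mem_Ici.2 hw) hw
  rwa [hf.zero] at this

theorem IsReturn.mul_le {f : ℝ → ℝ} (hf : IsReturn f) {w c : ℝ} (hw : 0 ≤ w) (hc : 0 ≤ c)
    (hc1 : c ≤ 1) : c * f w ≤ f (c * w) := by
  have := hf.concave.2 (Set.mem_Ici.2 le_rfl) (Set.mem_Ici.2 hw) (sub_nonneg.2 hc1) hc (by ring)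
  simpa [hf.zero] using this

theorem IsReturn.hasDerivAt {f : ℝ → ℝ} (hf : IsReturn f) {w : ℝ} (hw : 0 < w) :
    HasDerivAt f (slope f w) w := by
  have h : DifferentiableAt ℝ f w :=
    (hf.smooth.differentiableOn one_ne_zero).differentiableAt (Ioi_mem_nhds hw)
  rw [slope, derivWithin_of_mem_nhds (Ici_mem_nhds hw)]
  exact h.hasDerivAt

theorem IsReturn.slope_nonneg {f : ℝ → ℝ} (hf : IsReturn f) {w : ℝ} (hw : 0 < w) :
    0 ≤ slope f w := by
  have hw1 : (0 : ℝ) ≤ w + 1 := by linarith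
  have h := hf.concave.slope_le_of_hasDerivAt (Set.mem_Ici.2 hw.le) (Set.mem_Ici.2 hw1)
    (by linarith) (hf.hasDerivAt hw)
  rw [slope_def_field] at h
  have h2 := hf.mono (Set.mem_Ici.2 hw.le) (Set.mem_Ici.2 hw1) (by linarith)
  refine le_trans ?_ h
  exact div_nonneg (by linarith) (by linarith)

theorem IsReturn.le_tangent {f : ℝ → ℝ} (hf : IsReturn f) {w y : ℝ} (hw : 0 < w) (hy : 0 ≤ y) :
    f y ≤ f w + slope f w * (y - w) := by
  rcases lt_trichotomy w y with h | rfl | h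
  · have := hf.concave.slope_le_of_hasDerivAt (Set.mem_Ici.2 hw.le) (Set.mem_Ici.2 hy) h
      (hf.hasDerivAt hw)
    rw [slope_def_field, div_le_iff₀ (by linarith)] at this
    linarith
  · simp
  · have := hf.concave.le_slope_of_hasDerivAt (Set.mem_Ici.2 hy) (Set.mem_Ici.2 hw.le) h
      (hf.hasDerivAt hw)
    rw [slope_def_field, le_div_iff₀ (by linarith)] at this
    linarith

theorem gain_nonneg {m : ℕ} {M : Fin m → ℝ → ℝ} (hM : ∀ i, IsReturn (M i)) {u : Fin m → ℝ}
    (hu : ∀ i, 0 ≤ u i) : 0 ≤ gain M u :=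
  sum_nonneg fun i _ => (hM i).nonneg (hu i)

theorem IsFeasible.u_nonneg {m : ℕ} {J : Type*} [Fintype J] {b x : Fin m → J → ℝ}
    {u : Fin m → ℝ} (h : IsFeasible b x u) (hb : ∀ i j, 0 ≤ b i j) (i : Fin m) : 0 ≤ u i := by
  rw [← h.value i]
  exact sum_nonneg fun j _ => mul_nonneg (hb i j) (h.nonneg i j)

/-- Only upper bounds on `opt` and its nonnegativity are used later, so attainment of the maximum
plays no role. -/
theorem opt_le {m : ℕ} {J : Type*} [Fintype J] (M : Fin m → ℝ → ℝ) (b : Fin m → J → ℝ) {c : ℝ}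
    (hc : 0 ≤ c) (h : ∀ x u, IsFeasible b x u → gain M u ≤ c) : opt M b ≤ c := by
  refine Real.sSup_le ?_ hc
  rintro v ⟨x, u, hxu, rfl⟩
  exact h x u hxu

theorem opt_nonneg {m : ℕ} {J : Type*} [Fintype J] {M : Fin m → ℝ → ℝ}
    (hM : ∀ i, IsReturn (M i)) {b : Fin m → J → ℝ} (hb : ∀ i j, 0 ≤ b i j) : 0 ≤ opt M b := by
  refine Real.sSup_nonneg ?_
  rintro v ⟨x, u, hxu, rfl⟩
  exact gain_nonneg hM (hxu.u_nonneg hb)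

/-! ### Optimality conditions -/

/-- The value that `i` obtains from the item `j` at prices `p` if `i` is the only maximizer of
`b k j * p k`, and `0` otherwise. -/
noncomputable def clearValue {m : ℕ} {J : Type*} (b : Fin m → J → ℝ) (p : Fin m → ℝ) (i : Fin m)
    (j : J) : ℝ :=
  open Classical in if ∀ k, k ≠ i → b k j * p k < b i j * p i then b i j else 0

theorem exists_strict_of_existsUnique {m : ℕ} {q p : Fin m → ℝ} (h : ∃! i, IsArgmax q p i) :
    ∃ i, ∀ k, k ≠ i → q k * p k < q i * p i := by
  obtain ⟨i, hi, huniq⟩ := h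
  refine ⟨i, fun k hk => lt_of_le_of_ne (hi k) fun he => hk (huniq k fun l => ?_)⟩
  rw [he]
  exact hi l

theorem IsArgmax.eq_of_strict {m : ℕ} {q p : Fin m → ℝ} {i k : Fin m} (hk : IsArgmax q p k)
    (hi : ∀ l, l ≠ i → q l * p l < q i * p i) : k = i := by
  by_contra hne
  exact absurd (hi k hne) (not_lt.2 (hk i))

theorem clearValue_eq_of_strict {m : ℕ} {J : Type*} {b : Fin m → J → ℝ} {p : Fin m → ℝ}
    {i : Fin m} {j : J} (hi : ∀ k, k ≠ i → b k j * p k < b i j * p i) (k : Fin m) :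
    clearValue b p k j = if k = i then b k j else 0 := by
  unfold clearValue
  split_ifs with h1 h2 h2
  · rfl
  · exact absurd (h1 i (Ne.symm h2)) (hi k h2).not_gt
  · exact absurd (h2 ▸ hi) h1
  · rfl

theorem clearValue_nonneg {m : ℕ} {J : Type*} {b : Fin m → J → ℝ} (hb : ∀ i j, 0 ≤ b i j)
    (p : Fin m → ℝ) (i : Fin m) (j : J) : 0 ≤ clearValue b p i j := by
  unfold clearValue
  split_ifs
  exacts [hb i j, le_rfl]

theorem clearValue_le {m : ℕ} {J : Type*} {b : Fin m → J → ℝ} (hb : ∀ i j, 0 ≤ b i j)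
    (p : Fin m → ℝ) (i : Fin m) (j : J) : clearValue b p i j ≤ b i j := by
  unfold clearValue
  split_ifs
  exacts [le_rfl, hb i j]

/-- First-order optimality in the direction of another feasible point. -/
theorem IsOptimal.sum_slope_mul_sub_nonpos {m : ℕ} {J : Type*} [Fintype J] {M : Fin m → ℝ → ℝ}
    (hM : ∀ i, IsReturn (M i)) {b x : Fin m → J → ℝ} {u : Fin m → ℝ} (h : IsOptimal M b x u)
    (hu : ∀ i, 0 < u i) {x' : Fin m → J → ℝ} {u' : Fin m → ℝ} (h' : IsFeasible b x' u') :
    ∑ i, slope (M i) (u i) * (u' i - u i) ≤ 0 := by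
  by_contra! hpos
  set g : ℝ → ℝ := fun θ => gain M fun i => u i + θ * (u' i - u i) with hg
  have hd : HasDerivAt g (∑ i, slope (M i) (u i) * (u' i - u i)) 0 := by
    refine HasDerivAt.fun_sum fun i _ => ?_
    have h1 : HasDerivAt (fun θ : ℝ => u i + θ * (u' i - u i)) (u' i - u i) 0 := by
      simpa using ((hasDerivAt_id (0 : ℝ)).mul_const (u' i - u i)).const_add (u i)
    have h2 : HasDerivAt (M i) (slope (M i) (u i)) (u i + 0 * (u' i - u i)) := by
      simpa using (hM i).hasDerivAt (hu i)
    exact h2.comp 0 h1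
  have hle : ∀ θ ∈ Set.Ioo (0 : ℝ) 1, g θ ≤ g 0 := by
    rintro θ ⟨h0, h1⟩
    have hf : IsFeasible b (fun i j => x i j + θ * (x' i j - x i j))
        (fun i => u i + θ * (u' i - u i)) := by
      refine ⟨fun i => ?_, fun j => ?_, fun i j => ?_⟩
      · rw [← h.1.value i, ← h'.value i, ← sum_sub_distrib, mul_sum, ← sum_add_distrib]
        exact sum_congr rfl fun j _ => by ring
      · have e : ∑ i, (x i j + θ * (x' i j - x i j)) =
            (1 - θ) * ∑ i, x i j + θ * ∑ i, x' i j := by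
          rw [mul_sum, mul_sum, ← sum_add_distrib]
          exact sum_congr rfl fun i _ => by ring
        rw [e]
        nlinarith [h.1.le_one j, h'.le_one j]
      · nlinarith [mul_nonneg (sub_nonneg.2 h1.le) (h.1.nonneg i j),
          mul_nonneg h0.le (h'.nonneg i j)]
    have := h.2 _ _ hf
    simpa [hg] using this
  have ht := (hasDerivAt_iff_tendsto_slope.1 hd).mono_left
    (nhdsWithin_mono (0 : ℝ) (fun y (hy : y ∈ Set.Ioi (0 : ℝ)) => (ne_of_gt hy : y ≠ 0)))
  have hev := ht.eventually (lt_mem_nhds hpos)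
  obtain ⟨θ, hθ, h1⟩ := (hev.and (Ioo_mem_nhdsGT (zero_lt_one' ℝ))).exists
  rw [slope_def_field, sub_zero] at hθ
  have := (lt_div_iff₀ h1.1).1 hθ
  linarith [hle θ h1]

/-- An optimal solution matches an item with a unique maximizer entirely to this maximizer, as far
as values are concerned. -/
theorem IsOptimal.mul_eq_clearValue {m : ℕ} {J : Type*} [Fintype J] {M : Fin m → ℝ → ℝ}
    (hM : ∀ i, IsReturn (M i)) {b x : Fin m → J → ℝ} (hb : ∀ i j, 0 ≤ b i j) {u : Fin m → ℝ}
    (h : IsOptimal M b x u) (hu : ∀ i, 0 < u i) (hp : ∃ i, slope (M i) (u i) ≠ 0) {j : J}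
    (hj : ∃! i, IsArgmax (fun k => b k j) (fun k => slope (M k) (u k)) i) (k : Fin m) :
    b k j * x k j = clearValue b (fun k => slope (M k) (u k)) k j := by
  classical
  obtain ⟨i, hi⟩ := exists_strict_of_existsUnique hj
  rw [clearValue_eq_of_strict hi]
  set p : Fin m → ℝ := fun k => slope (M k) (u k) with hpdef
  have hp0 : ∀ k, 0 ≤ p k := fun k => (hM k).slope_nonneg (hu k)
  -- The competitor rematches the single item `j` entirely to `i`.
  have hfeas : IsFeasible b (fun k l => if l = j then (if k = i then 1 else 0) else x k l)
      (fun k => u k + b k j * ((if k = i then 1 else 0) - x k j)) := by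
    refine ⟨fun k => ?_, fun l => ?_, fun k l => ?_⟩
    · rw [← h.1.value k, ← add_sum_erase univ _ (mem_univ j), ← add_sum_erase univ _ (mem_univ j),
        sum_congr rfl fun l hl => by rw [if_neg (ne_of_mem_erase hl)]]
      simp only [if_true]
      ring
    · by_cases hl : l = j
      · simp [hl]
      · simpa [hl] using h.1.le_one l
    · split_ifs
      exacts [zero_le_one, le_rfl, h.1.nonneg k l]
  have hfo := h.sum_slope_mul_sub_nonpos hM hu hfeas
  have h1 : b i j * p i ≤ ∑ k, b k j * p k * x k j := by
    have e : ∑ k, slope (M k) (u k) * (u k + b k j * ((if k = i then 1 else 0) - x k j) - u k) =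
        b i j * p i - ∑ k, b k j * p k * x k j := by
      have e' : b i j * p i = ∑ k, if k = i then b k j * p k else 0 := by simp
      rw [e', ← sum_sub_distrib]
      refine sum_congr rfl fun k _ => ?_
      simp only [hpdef]
      split_ifs <;> ring
    linarith
  have hcol := h.1.le_one j
  rw [← add_sum_erase univ _ (mem_univ i)] at h1 hcol
  have hmax0 : 0 ≤ b i j * p i := mul_nonneg (hb i j) (hp0 i)
  have hzero : ∀ k ≠ i, x k j = 0 := by
    by_contra! hne
    obtain ⟨k, hk, hxk⟩ := hne
    have hxk' : 0 < x k j := lt_of_le_of_ne (h.1.nonneg k j) (Ne.symm hxk)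
    have hlt : ∑ k ∈ univ.erase i, b k j * p k * x k j <
        ∑ k ∈ univ.erase i, b i j * p i * x k j := by
      refine sum_lt_sum (fun l hl => ?_) ⟨k, mem_erase.2 ⟨hk, mem_univ _⟩, ?_⟩
      · exact mul_le_mul_of_nonneg_right (hi l (ne_of_mem_erase hl)).le (h.1.nonneg l j)
      · exact mul_lt_mul_of_pos_right (hi k hk) hxk'
    rw [← mul_sum] at hlt
    nlinarith
  by_cases hk : k = i
  · subst hk
    rw [if_pos rfl]
    rw [sum_eq_zero fun l hl => by rw [hzero l (ne_of_mem_erase hl), mul_zero], add_zero] at h1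
    rw [sum_eq_zero fun l hl => hzero l (ne_of_mem_erase hl), add_zero] at hcol
    -- If the strict maximum is `0`, no other index can exist. The nonzero price is then that of
    -- `k`, so `b k j = 0` and the fraction `x k j` is irrelevant.
    rcases hmax0.eq_or_lt with h0 | h0
    · have hsub : ∀ l, l = k := by
        intro l
        by_contra hl
        have := hi l hl
        linarith [mul_nonneg (hb l j) (hp0 l)]
      obtain ⟨l, hl⟩ := hp
      rw [hsub l] at hl
      have : b k j = 0 := by
        rcases mul_eq_zero.1 h0.symm with h | h
        exacts [h, absurd h hl]
      rw [this, zero_mul]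
    · have : x k j = 1 := le_antisymm hcol (by nlinarith)
      rw [this, mul_one]
  · rw [if_neg hk, hzero k hk, mul_zero]

/-! ### Behaviour on a fixed arrival sequence -/

/-- Weak duality: tangents at `u` bound the concave gain by a linear one, whose maximization
decouples over the items. Optimality of `u` is not needed. -/
theorem IsFeasible.gain_le {m : ℕ} {J : Type*} [Fintype J] {M : Fin m → ℝ → ℝ}
    (hM : ∀ i, IsReturn (M i)) {b x' : Fin m → J → ℝ} (hb : ∀ i j, 0 ≤ b i j) {u u' : Fin m → ℝ}
    (hu : ∀ i, 0 < u i) (h' : IsFeasible b x' u') (κ : J → Fin m)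
    (hκ : ∀ j, IsArgmax (fun k => b k j) (fun k => slope (M k) (u k)) (κ j)) :
    gain M u' ≤ ∑ i, (M i (u i) +
      slope (M i) (u i) * ((∑ j, if κ j = i then b i j else 0) - u i)) := by
  set p : Fin m → ℝ := fun k => slope (M k) (u k) with hp
  have hp0 : ∀ k, 0 ≤ p k := fun k => (hM k).slope_nonneg (hu k)
  have h1 : gain M u' ≤ ∑ i, (M i (u i) + p i * (u' i - u i)) :=
    sum_le_sum fun i _ => (hM i).le_tangent (hu i) (h'.u_nonneg hb i)
  have h2 : ∑ i, p i * u' i ≤ ∑ i, p i * ∑ j, if κ j = i then b i j else 0 := by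
    simp_rw [← h'.value, mul_sum]
    rw [sum_comm]
    nth_rw 2 [sum_comm]
    refine sum_le_sum fun j _ => ?_
    have e : ∑ i, p i * (if κ j = i then b i j else 0) = b (κ j) j * p (κ j) := by
      simp [mul_comm]
    rw [e]
    calc ∑ i, p i * (b i j * x' i j) ≤ ∑ i, b (κ j) j * p (κ j) * x' i j := by
          refine sum_le_sum fun i _ => ?_
          have := mul_le_mul_of_nonneg_right (hκ j i) (h'.nonneg i j)
          linarith
      _ = b (κ j) j * p (κ j) * ∑ i, x' i j := by rw [mul_sum]
      _ ≤ b (κ j) j * p (κ j) :=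
          mul_le_of_le_one_right (mul_nonneg (hb _ _) (hp0 _)) (h'.le_one j)
  refine h1.trans ?_
  simp only [mul_sub, sum_add_distrib, sum_sub_distrib] at h2 ⊢
  linarith

/-- Chains `δ * w ≈ S ≈ μ ≈ δ * Y`. The additive errors `m` and `1` are absorbed through `m + 1 ≤ τ
* B ≤ τ * (δ * w)`. -/
theorem abs_sub_le_of_sample {m δ τ B S Y w μ : ℝ} (hm : 0 ≤ m) (hτ : 0 < τ) (hτ1 : τ ≤ 1 / 10)
    (hB : m + 1 ≤ τ * B) (hw : B ≤ δ * w) (hS : |S - δ * w| ≤ m)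
    (hμ : |S - μ| ≤ τ * max μ B) (hY : |μ - δ * Y| ≤ 1) : |δ * Y - δ * w| ≤ 4 * τ * (δ * w) := by
  set D := δ * w
  obtain ⟨a1, a2⟩ := abs_le.1 hS
  obtain ⟨c1, c2⟩ := abs_le.1 hY
  have hB0 : 0 < B := by
    by_contra! h
    nlinarith
  have hBD := mul_le_mul_of_nonneg_left hw hτ.le
  rcases le_total μ B with h | h
  · rw [max_eq_right h] at hμ
    obtain ⟨b1, b2⟩ := abs_le.1 hμ
    rw [abs_le]
    constructor <;> nlinarith
  · rw [max_eq_left h] at hμ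
    obtain ⟨b1, b2⟩ := abs_le.1 hμ
    have u1 : (1 - τ) * μ ≤ D + m := by linarith
    have u2 : D - m ≤ (1 + τ) * μ := by linarith
    have hμD : μ ≤ 10 / 9 * (D + m) := by nlinarith
    have hmD : m ≤ D / 10 := by nlinarith
    have e1 := mul_le_mul_of_nonneg_left hμD hτ.le
    have e2 := mul_le_mul_of_nonneg_left hmD hτ.le
    rw [abs_le]
    constructor <;> nlinarith

/-- If the sample represents the clear values, then the algorithm is nearly optimal. -/
theorem IsOLARun.mul_opt_le_gain {m n s : ℕ} {M : Fin m → ℝ → ℝ} (hM : ∀ i, IsReturn (M i))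
    {a : Fin m → Fin n → ℝ} (ha : ∀ i j, a i j ∈ Set.Icc (0 : ℝ) 1) (hgp : GeneralPosition a)
    (hn : 0 < n) {δ τ B : ℝ} (hδ : 0 < δ) (hδ1 : δ ≤ 1) (hs : |(s : ℝ) - δ * n| < 1)
    (hτ : 0 < τ) (hτ1 : τ ≤ 1 / 10) (hB : (m : ℝ) + 1 ≤ τ * B) {u : Fin m → ℝ}
    {x : Fin m → Fin n → ℝ} (h : IsOLARun M δ s a u x) (hu : ∀ i, B ≤ δ * u i)
    (hp : ∃ i, slope (M i) (u i) ≠ 0)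
    (hconc : ∀ i, |∑ j with (j : Fin n).val < s, clearValue a (fun k => slope (M k) (u k)) i j -
        s * (∑ j, clearValue a (fun k => slope (M k) (u k)) i j) / n| ≤
      τ * max (s * (∑ j, clearValue a (fun k => slope (M k) (u k)) i j) / n) B) :
    (1 - δ - 10 * τ) * opt M a ≤ gain M fun i => ∑ j, a i j * x i j := by
  classical
  set p : Fin m → ℝ := fun k => slope (M k) (u k) with hpdef
  have ha0 : ∀ i j, 0 ≤ a i j := fun i j => (ha i j).1
  have hB0 : 0 < B := by
    by_contra! h
    have : (0 : ℝ) ≤ m := Nat.cast_nonneg _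
    nlinarith
  have hu0 : ∀ i, 0 < u i := fun i => by
    by_contra! h
    have := hu i
    nlinarith
  have hp0 : ∀ i, 0 ≤ p i := fun i => (hM i).slope_nonneg (hu0 i)
  have hpne : p ≠ 0 := by
    obtain ⟨i, hi⟩ := hp
    exact fun h => hi (congrFun h i)
  set U : Finset (Fin n) := univ.filter fun j => ¬ ∃! i, IsArgmax (fun k => a k j) p i with hU
  have hUcard : (#U : ℝ) ≤ m := by
    have := hgp p hp0 hpne
    rw [← Set.ncard_coe_finset U] at *
    rw [hU, coe_filter]
    simpa using this
  have hsumU : ∀ s : Finset (Fin n), (∑ j ∈ s, if j ∈ U then (1 : ℝ) else 0) ≤ m := by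
    intro s
    refine le_trans ?_ hUcard
    rw [sum_boole]
    exact_mod_cast card_le_card fun j hj => (mem_filter.1 hj).2
  set Y : Fin m → ℝ := fun i => ∑ j, clearValue a p i j with hY
  set S : Fin m → ℝ := fun i => ∑ j with (j : Fin n).val < s, clearValue a p i j with hS
  have hstrict : ∀ j ∉ U, ∃! i, IsArgmax (fun k => a k j) p i := by
    intro j hj
    by_contra hcon
    exact hj (mem_filter.2 ⟨mem_univ _, hcon⟩)
  -- Only tied items contribute, each at most `1`. Dividing the weights by `δ` does not change the
  -- maximizers.
  have hsample : ∀ i, |S i - δ * u i| ≤ m := by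
    intro i
    obtain ⟨xhat, hopt⟩ := h.learn
    have hval : δ * u i = ∑ j : {j : Fin n // (j : ℕ) < s}, a i j.1 * xhat i j := by
      rw [← hopt.1.value i, mul_sum]
      refine sum_congr rfl fun j _ => ?_
      rw [sampleWeights]
      field_simp
    have hSi : S i = ∑ j : {j : Fin n // (j : ℕ) < s}, clearValue a p i j.1 :=
      sum_subtype _ (by simp) _
    rw [hval, hSi, ← sum_sub_distrib]
    refine (abs_sum_le_sum_abs _ _).trans (le_trans ?_ (hsumU (univ.filter fun j => j.val < s)))
    rw [sum_subtype (p := fun j : Fin n => j.val < s) _ (by simp)]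
    refine sum_le_sum fun j _ => ?_
    have hle1 : xhat i j ≤ 1 :=
      (single_le_sum (fun k _ => hopt.1.nonneg k j) (mem_univ i)).trans (hopt.1.le_one j)
    have hx0 := hopt.1.nonneg i j
    split_ifs with hj
    · have h1 := clearValue_nonneg ha0 p i j.1
      have h2 := (clearValue_le ha0 p i j.1).trans (ha i j.1).2
      have h3 : a i j.1 * xhat i j ≤ 1 := mul_le_one₀ (ha i j.1).2 hx0 hle1
      have h4 := mul_nonneg (ha0 i j.1) hx0
      rw [abs_le]
      constructor <;> linarith
    · have hdiv : ∀ k l, sampleWeights δ s a k j * p k < sampleWeights δ s a l j * p l ↔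
          a k j.1 * p k < a l j.1 * p l := by
        intro k l
        rw [sampleWeights, sampleWeights, div_mul_eq_mul_div, div_mul_eq_mul_div,
          div_lt_div_iff_of_pos_right hδ]
      have hdiv' : ∀ k, IsArgmax (fun k => sampleWeights δ s a k j) p k ↔
          IsArgmax (fun k => a k j.1) p k := by
        intro k
        refine forall_congr' fun l => ?_
        rw [← not_lt, ← not_lt, hdiv]
      have hj' : ∃! i, IsArgmax (fun k => sampleWeights δ s a k j) p i := by
        simpa only [hdiv'] using hstrict j.1 hj
      have hb' : ∀ i j, 0 ≤ sampleWeights δ s a i j := fun i j => div_nonneg (ha0 i j.1) hδ.le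
      have key : sampleWeights δ s a i j * xhat i j = clearValue (sampleWeights δ s a) p i j :=
        hopt.mul_eq_clearValue hM hb' hu0 hp hj' i
      have hcl : clearValue (sampleWeights δ s a) p i j = clearValue a p i j.1 / δ := by
        unfold clearValue
        simp only [hdiv]
        split_ifs
        · rfl
        · simp
      rw [hcl, sampleWeights, div_mul_eq_mul_div, div_left_inj' hδ.ne'] at key
      rw [key, sub_self, abs_zero]
  have hn' : (0 : ℝ) < n := by exact_mod_cast hn
  -- Rounding `δ * n` to `s` costs at most `1`, because `Y i ≤ n`.
  have hmean : ∀ i, |s * Y i / n - δ * Y i| ≤ 1 := by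
    intro i
    have hY0 : 0 ≤ Y i := sum_nonneg fun j _ => clearValue_nonneg ha0 p i j
    have hYn : Y i ≤ n := by
      refine (sum_le_sum fun j _ => (clearValue_le ha0 p i j).trans (ha i j).2).trans ?_
      simp
    have e : s * Y i / n - δ * Y i = (s - δ * n) * (Y i / n) := by field_simp
    rw [e, abs_mul, abs_of_nonneg (div_nonneg hY0 hn'.le)]
    exact mul_le_one₀ hs.le (div_nonneg hY0 hn'.le) ((div_le_one hn').2 hYn)
  have hdev : ∀ i, |δ * Y i - δ * u i| ≤ 4 * τ * (δ * u i) := fun i =>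
    abs_sub_le_of_sample (Nat.cast_nonneg m) hτ hτ1 hB (hu i) (hsample i) (hconc i) (hmean i)
  have hmB : ∀ i, (m : ℝ) ≤ τ * (δ * u i) := fun i => by
    have := mul_le_mul_of_nonneg_left (hu i) hτ.le
    linarith
  -- the algorithm receives almost the predicted value
  have hx01 : ∀ i j, 0 ≤ x i j := by
    intro i j
    rcases lt_or_ge (j : ℕ) s with hj | hj
    · rw [h.explore i j hj]
    · obtain ⟨k, -, hk⟩ := h.exploit j hj
      rw [hk i]
      split_ifs
      exacts [zero_le_one, le_rfl]
  have hR0 : ∀ i, 0 ≤ ∑ j, a i j * x i j := fun i =>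
    sum_nonneg fun j _ => mul_nonneg (ha0 i j) (hx01 i j)
  have hR : ∀ i, (1 - δ - 5 * τ) * u i ≤ ∑ j, a i j * x i j := by
    intro i
    have h1 : Y i - S i ≤ ∑ j, a i j * x i j := by
      rw [sub_le_iff_le_add]
      simp only [hY, hS, sum_filter]
      rw [← sum_add_distrib]
      refine sum_le_sum fun j _ => ?_
      split_ifs with hj
      · linarith [mul_nonneg (ha0 i j) (hx01 i j)]
      · obtain ⟨k, hk, hxk⟩ := h.exploit j (not_lt.1 hj)
        rw [hxk i, add_zero]
        by_cases hi : ∀ k, k ≠ i → a k j * p k < a i j * p i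
        · rw [hk.eq_of_strict hi, if_pos rfl, mul_one]
          exact clearValue_le ha0 p i j
        · rw [clearValue, if_neg hi]
          split_ifs <;> simp [ha0 i j]
    refine le_trans ?_ h1
    have h2 := (abs_le.1 (hdev i)).1
    have h3 := (abs_le.1 (hsample i)).2
    have h4 := hmB i
    have h5 : δ * S i ≤ δ * ((1 + τ) * (δ * u i)) := mul_le_mul_of_nonneg_left (by linarith) hδ.le
    have h6 : δ * (τ * (δ * u i)) ≤ 1 * (τ * (δ * u i)) :=
      mul_le_mul_of_nonneg_right hδ1 (by positivity [hu0 i])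
    refine le_of_mul_le_mul_left ?_ hδ
    nlinarith
  -- duality
  have hex : ∀ j, ∃ k, IsArgmax (fun k => a k j) p k := by
    intro j
    obtain ⟨i, -⟩ := hp
    obtain ⟨k, -, hk⟩ := exists_max_image univ (fun k => a k j * p k) ⟨i, mem_univ _⟩
    exact ⟨k, fun l => hk l (mem_univ _)⟩
  choose κ hκ using hex
  have hV : ∀ i, (∑ j, if κ j = i then a i j else 0) ≤ (1 + 5 * τ) * u i := by
    intro i
    have h1 : (∑ j, if κ j = i then a i j else 0) ≤ Y i + m := by
      refine le_trans ?_ (add_le_add le_rfl (hsumU univ))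
      rw [hY, ← sum_add_distrib]
      refine sum_le_sum fun j _ => ?_
      by_cases hj : j ∈ U
      · rw [if_pos hj]
        have := clearValue_nonneg ha0 p i j
        split_ifs
        · linarith [(ha i j).2]
        · linarith
      · rw [if_neg hj, add_zero]
        obtain ⟨l, hl⟩ := exists_strict_of_existsUnique (hstrict j hj)
        rw [(hκ j).eq_of_strict hl, clearValue_eq_of_strict hl i]
        simp only [eq_comm, le_refl]
    refine h1.trans ?_
    have h2 := (abs_le.1 (hdev i)).2
    have h3 : δ * m ≤ 1 * m := mul_le_mul_of_nonneg_right hδ1 (Nat.cast_nonneg _)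
    have h4 := hmB i
    refine le_of_mul_le_mul_left ?_ hδ
    nlinarith
  have hG0 : 0 ≤ gain M u := gain_nonneg hM fun i => (hu0 i).le
  -- The tangent at `u i` evaluated at `0` gives `p i * u i ≤ M i (u i)`, which turns the excess `5
  -- * τ * u i` into a fraction of the gain.
  have hopt : opt M a ≤ (1 + 5 * τ) * gain M u := by
    refine opt_le M a (by positivity) fun x' u' h' => (h'.gain_le hM ha0 hu0 κ hκ).trans ?_
    rw [gain, mul_sum]
    refine sum_le_sum fun i _ => ?_
    have h1 := mul_le_mul_of_nonneg_left (hV i) (hp0 i)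
    have h2 := (hM i).le_tangent (hu0 i) le_rfl
    rw [(hM i).zero] at h2
    simp only [hpdef] at h1
    nlinarith
  have hopt0 := opt_nonneg hM ha0
  rcases le_or_gt 0 (1 - δ - 5 * τ) with hc | hc
  · have h1 : (1 - δ - 5 * τ) * gain M u ≤ gain M fun i => ∑ j, a i j * x i j := by
      rw [gain, gain, mul_sum]
      refine sum_le_sum fun i _ => ((hM i).mul_le (hu0 i).le hc (by linarith)).trans ?_
      exact (hM i).mono (Set.mem_Ici.2 (mul_nonneg hc (hu0 i).le)) (Set.mem_Ici.2 (hR0 i)) (hR i)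
    refine le_trans ?_ h1
    have h2 : (1 - δ - 10 * τ) * opt M a ≤ (1 - δ - 5 * τ) * ((1 - 5 * τ) * opt M a) := by
      nlinarith [mul_nonneg hopt0 (mul_nonneg hτ.le (show 0 ≤ δ + 5 * τ by positivity))]
    refine h2.trans (mul_le_mul_of_nonneg_left ?_ hc)
    have h3 := mul_le_mul_of_nonneg_left hopt (show 0 ≤ 1 - 5 * τ by linarith)
    nlinarith [mul_nonneg (sq_nonneg τ) hG0]
  · have : (1 - δ - 10 * τ) * opt M a ≤ 0 :=
      mul_nonpos_of_nonpos_of_nonneg (by linarith) hopt0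
    exact this.trans (gain_nonneg hM hR0)

/-! ### Random arrival order -/

/-- The existential over `p` inside the event lets the bound be applied to prices learned from the
sample itself. The infinitely many `p` reduce to finitely many positivity patterns. -/
theorem card_exists_clearValue_deviation_le {m n s : ℕ} (hs : s ≤ n) (hn : 0 < n)
    (b : Fin m → Fin n → ℝ) (hb : ∀ i j, b i j ∈ Set.Icc (0 : ℝ) 1) {τ B : ℝ} (hτ : 0 ≤ τ)
    (hτ1 : τ ≤ 1) :
    ({σ : Equiv.Perm (Fin n) | ∃ (p : Fin m → ℝ) (i : Fin m),
        τ * max (s * (∑ j, clearValue b p i j) / n) B <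
          |∑ j with (j : Fin n).val < s, clearValue b p i (σ j) -
            s * (∑ j, clearValue b p i j) / n|}.ncard : ℝ) ≤
      n.factorial * (((m : ℝ) ^ 2 * n + 1) ^ m * m * (2 * Real.exp (-(τ ^ 2 * B / 4)))) := by
  classical
  let v : Fin m × Fin m × Fin n → Fin m → ℝ := fun e l =>
    (if l = e.1 then b e.1 e.2.2 else 0) - (if l = e.2.1 then b e.2.1 e.2.2 else 0)
  have hv : ∀ e (p : Fin m → ℝ), ∑ l, v e l * p l = b e.1 e.2.2 * p e.1 - b e.2.1 e.2.2 * p e.2.1 := by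
    intro e p
    simp [v, sub_mul, sum_sub_distrib]
  let 𝒜 : Finset (Finset (Fin m × Fin m × Fin n)) :=
    univ.filter fun A => ∃ p : Fin m → ℝ, ∀ e, e ∈ A ↔ 0 < ∑ i, v e i * p i
  have h𝒜 : (#𝒜 : ℝ) ≤ ((m : ℝ) ^ 2 * n + 1) ^ m := by
    have := card_positivity_patterns_le v 𝒜 fun A hA => (mem_filter.1 hA).2
    simp only [Fintype.card_prod, Fintype.card_fin] at this
    have h2 : (#𝒜 : ℝ) ≤ ((m * (m * n) + 1) ^ m : ℕ) := by exact_mod_cast this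
    refine h2.trans (le_of_eq ?_)
    push_cast
    ring
  -- The clear values read off from a pattern alone.
  let w : Finset (Fin m × Fin m × Fin n) → Fin m → Fin n → ℝ := fun A i j =>
    if ∀ k, k ≠ i → (i, k, j) ∈ A then b i j else 0
  have hw : ∀ A i j, w A i j ∈ Set.Icc (0 : ℝ) 1 := by
    intro A i j
    simp only [w]
    split_ifs
    exacts [hb i j, ⟨le_rfl, zero_le_one⟩]
  let bad : Finset (Fin m × Fin m × Fin n) → Fin m → Finset (Equiv.Perm (Fin n)) := fun A i =>
    univ.filter fun σ => τ * max (s * (∑ j, w A i j) / n) B <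
        |∑ j with (j : Fin n).val < s, w A i (σ j) - s * (∑ j, w A i j) / n|
  have hsub : {σ : Equiv.Perm (Fin n) | ∃ (p : Fin m → ℝ) (i : Fin m),
        τ * max (s * (∑ j, clearValue b p i j) / n) B <
          |∑ j with (j : Fin n).val < s, clearValue b p i (σ j) -
            s * (∑ j, clearValue b p i j) / n|} ⊆
      ((𝒜 ×ˢ (univ : Finset (Fin m))).biUnion fun q => bad q.1 q.2 :
        Finset (Equiv.Perm (Fin n))) := by
    rintro σ ⟨p, i, hσ⟩
    let A : Finset (Fin m × Fin m × Fin n) := univ.filter fun e => 0 < ∑ i, v e i * p i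
    have hA : A ∈ 𝒜 := mem_filter.2 ⟨mem_univ _, p, fun e => by simp [A]⟩
    have hwA : ∀ j, clearValue b p i j = w A i j := by
      intro j
      simp only [clearValue, w, A, mem_filter, mem_univ, true_and, hv, sub_pos]
    rw [mem_coe, mem_biUnion]
    refine ⟨(A, i), mem_product.2 ⟨hA, mem_univ _⟩, mem_filter.2 ⟨mem_univ _, ?_⟩⟩
    simpa only [hwA] using hσ
  have h1 := Set.ncard_le_ncard hsub (finite_toSet _)
  rw [Set.ncard_coe_finset] at h1
  have h2 : ∀ q ∈ 𝒜 ×ˢ (univ : Finset (Fin m)), (#(bad q.1 q.2) : ℝ) ≤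
      n.factorial * (2 * Real.exp (-(τ ^ 2 * B / 4))) := fun q _ =>
    card_perm_deviation_le hs hn (w q.1 q.2) (hw q.1 q.2) hτ hτ1
  calc _ ≤ (#((𝒜 ×ˢ (univ : Finset (Fin m))).biUnion fun q => bad q.1 q.2) : ℝ) := by
        exact_mod_cast h1
    _ ≤ ∑ q ∈ 𝒜 ×ˢ (univ : Finset (Fin m)), (#(bad q.1 q.2) : ℝ) := by
        exact_mod_cast card_biUnion_le
    _ ≤ (#(𝒜 ×ˢ (univ : Finset (Fin m))) : ℝ) *
          (n.factorial * (2 * Real.exp (-(τ ^ 2 * B / 4)))) := by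
        rw [← nsmul_eq_mul]
        exact sum_le_card_nsmul _ _ _ h2
    _ = #𝒜 * (m * (n.factorial * (2 * Real.exp (-(τ ^ 2 * B / 4))))) := by
        rw [card_product, card_univ, Fintype.card_fin]
        push_cast
        ring
    _ ≤ ((m : ℝ) ^ 2 * n + 1) ^ m * (m * (n.factorial * (2 * Real.exp (-(τ ^ 2 * B / 4))))) := by
        gcongr
    _ = _ := by ring

theorem GeneralPosition.arrivals {m n : ℕ} {b : Fin m → Fin n → ℝ} (h : GeneralPosition b)
    (σ : Equiv.Perm (Fin n)) : GeneralPosition (arrivals b σ) := by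
  intro p hp hp0
  refine le_trans (le_of_eq ?_) (h p hp hp0)
  exact Set.ncard_preimage_of_injective_subset_range (f := σ)
    (s := {j : Fin n | ¬ ∃! i, IsArgmax (fun k => b k j) p i}) σ.injective (by simp)

theorem opt_arrivals {m n : ℕ} (M : Fin m → ℝ → ℝ) (b : Fin m → Fin n → ℝ)
    (σ : Equiv.Perm (Fin n)) : opt M (arrivals b σ) = opt M b := by
  have key : ∀ (b x : Fin m → Fin n → ℝ) (u : Fin m → ℝ) (σ : Equiv.Perm (Fin n)),
      IsFeasible b x u → IsFeasible (arrivals b σ) (arrivals x σ) u := by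
    intro b x u σ h
    exact ⟨fun i => (Equiv.sum_comp σ fun j => b i j * x i j).trans (h.value i),
      fun j => h.le_one (σ j), fun i j => h.nonneg i (σ j)⟩
  unfold opt
  congr 1
  ext v
  constructor
  · rintro ⟨x, u, h, hv⟩
    refine ⟨arrivals x σ.symm, u, ?_, hv⟩
    have := key _ _ _ σ.symm h
    rwa [show arrivals (arrivals b σ) σ.symm = b by
      ext i j; simp [arrivals]] at this
  · rintro ⟨x, u, h, hv⟩
    exact ⟨_, u, key _ _ _ σ h, hv⟩

theorem opt_eq_zero {m n : ℕ} {M : Fin m → ℝ → ℝ} (hM : ∀ i, IsReturn (M i))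
    {b : Fin m → Fin n → ℝ} (hb : ∀ i j, 0 ≤ b i j) (h : m = 0 ∨ n = 0) : opt M b = 0 := by
  refine le_antisymm (opt_le M b le_rfl fun x u hxu => ?_) (opt_nonneg hM hb)
  refine (sum_eq_zero fun i _ => ?_).le
  rcases h with rfl | rfl
  · exact i.elim0
  · rw [← hxu.value i]
    simpa using (hM i).zero

/-- The numerical conditions on the threshold used in the main estimate. -/
theorem threshold_bounds {κ ε : ℝ} (hκ : κ ∈ Set.Ioo (0 : ℝ) 1) (hε : ε ∈ Set.Ioo (0 : ℝ) (1 / 2))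
    {m n : ℕ} (hm : 0 < m) (hn : 0 < n) {τ B : ℝ} (hτ : τ = (1 - κ) * ε / 20)
    (hB : B = κ * ε * (1600 * (4 + 2 / (1 - κ)) / ((1 - κ) ^ 2 * κ) *
      (m * Real.log ((m : ℝ) ^ 2 * n / ε) / ε ^ 3))) :
    (m : ℝ) + 1 ≤ τ * B ∧
      ((m : ℝ) ^ 2 * n + 1) ^ m * m * (2 * Real.exp (-(τ ^ 2 * B / 4))) ≤ (1 - κ) * ε / 2 := by
  obtain ⟨hκ0, hκ1⟩ := hκ
  obtain ⟨hε0, hε1⟩ := hε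
  have hk : 0 < 1 - κ := sub_pos.2 hκ1
  have hm1 : (1 : ℝ) ≤ m := by exact_mod_cast hm
  have hn1 : (1 : ℝ) ≤ n := by exact_mod_cast hn
  -- The summands `1 + 1 + 2 + 2 / (1 - κ)` of `K` pay for the factors `(N + 1) ^ m`, `m / ε`, `4`
  -- and `1 / (1 - κ)`, respectively.
  set K : ℝ := 4 + 2 / (1 - κ) with hK
  have hK4 : 4 ≤ K := by
    have : 0 < 2 / (1 - κ) := by positivity
    linarith
  set N : ℝ := (m : ℝ) ^ 2 * n with hN
  have hN1 : 1 ≤ N := one_le_mul_of_one_le_of_one_le (one_le_pow₀ hm1) hn1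
  have hmN : m ≤ N := by
    rw [hN, sq, mul_assoc]
    exact le_mul_of_one_le_right (by positivity) (one_le_mul_of_one_le_of_one_le hm1 hn1)
  set l : ℝ := Real.log (N / ε) with hl
  have hNε : 0 < N / ε := by positivity
  have hexp : Real.exp l = N / ε := Real.exp_log hNε
  have h2N : 2 * N ≤ N / ε := by
    rw [le_div_iff₀ hε0]
    nlinarith
  have hl2 : 1 / 2 ≤ l := by
    have h1 : Real.log 2 ≤ l := Real.log_le_log (by norm_num) (by linarith)
    linarith [Real.log_two_gt_d9]
  have hml : l ≤ m * l := le_mul_of_one_le_left (by linarith) hm1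
  constructor
  · have e : τ * B = 80 * K * (m * l) / ((1 - κ) * ε) := by
      rw [hτ, hB]; field_simp; ring
    rw [e, le_div_iff₀ (by positivity)]
    have h1 : (1 - κ) * ε ≤ 1 := by nlinarith
    have h2 : (m : ℝ) / 2 ≤ m * l := by nlinarith
    nlinarith
  -- The constant `1600 = 4 * 20 ^ 2` makes this exact; `ε ^ 3` cancels `ε ^ 2` from `τ ^ 2` and `ε`
  -- from `δ`.
  · have e : τ ^ 2 * B / 4 = K * (m * l) := by
      rw [hτ, hB]; field_simp; ring
    rw [e]
    have p1 : (N + 1) ^ m ≤ Real.exp (m * l) := by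
      rw [Real.exp_nat_mul, hexp]
      exact pow_le_pow_left₀ (by linarith) (by linarith) m
    have p2 : m / ε ≤ Real.exp (m * l) :=
      calc m / ε ≤ N / ε := by gcongr
        _ = Real.exp l := hexp.symm
        _ ≤ _ := Real.exp_le_exp.2 hml
    have p3 : 4 ≤ Real.exp (2 * (m * l)) :=
      calc (4 : ℝ) ≤ (N / ε) ^ 2 := by nlinarith
        _ = Real.exp (2 * l) := by
          rw [← hexp, ← Real.exp_nat_mul]; norm_num
        _ ≤ _ := Real.exp_le_exp.2 (by linarith)
    have p4 : 1 / (1 - κ) ≤ Real.exp (2 / (1 - κ) * (m * l)) := by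
      have h1 : 1 / (1 - κ) ≤ 2 / (1 - κ) * (m * l) := by
        rw [div_mul_eq_mul_div]
        gcongr
        linarith
      exact h1.trans ((by linarith : _ ≤ 2 / (1 - κ) * (m * l) + 1).trans (Real.add_one_le_exp _))
    have hsplit : Real.exp (K * (m * l)) = Real.exp (m * l) * Real.exp (m * l) *
        Real.exp (2 * (m * l)) * Real.exp (2 / (1 - κ) * (m * l)) := by
      rw [← Real.exp_add, ← Real.exp_add, ← Real.exp_add, hK]
      congr 1
      ring
    have hprod : (N + 1) ^ m * (m / ε) * 4 * (1 / (1 - κ)) ≤ Real.exp (K * (m * l)) := by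
      rw [hsplit]
      gcongr
    rw [Real.exp_neg, ← mul_assoc, ← div_eq_mul_inv, div_le_iff₀ (Real.exp_pos _)]
    have := mul_le_mul_of_nonneg_left hprod (show 0 ≤ (1 - κ) * ε / 2 by positivity)
    refine le_trans (le_of_eq ?_) this
    field_simp
    ring

/-- Orders that violate the threshold or show a deviation contribute a nonnegative gain and are
discarded; on all others the estimate is deterministic, so no conditioning on the learned prices
occurs. -/
theorem isCompetitive_of_threshold {κ ε : ℝ} (hκ : κ ∈ Set.Ioo (0 : ℝ) 1)
    (hε : ε ∈ Set.Ioo (0 : ℝ) (1 / 2)) {m n s : ℕ} (hs : |(s : ℝ) - κ * ε * n| < 1)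
    {M : Fin m → ℝ → ℝ} (hM : ∀ i, IsReturn (M i)) {b : Fin m → Fin n → ℝ}
    (hb : ∀ i j, b i j ∈ Set.Icc (0 : ℝ) 1) (hgp : GeneralPosition b)
    {u : Equiv.Perm (Fin n) → Fin m → ℝ} {x : Equiv.Perm (Fin n) → Fin m → Fin n → ℝ}
    (hrun : ∀ σ, IsOLARun M (κ * ε) s (arrivals b σ) (u σ) (x σ)) {η : ℝ} (hη : 0 ≤ η)
    (hprob : 1 - η ≤ orderProb {σ : Equiv.Perm (Fin n) |
      (∀ i, 1600 * (4 + 2 / (1 - κ)) / ((1 - κ) ^ 2 * κ) *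
        (m * Real.log ((m : ℝ) ^ 2 * n / ε) / ε ^ 3) ≤ u σ i) ∧ ∃ i, slope (M i) (u σ i) ≠ 0}) :
    IsCompetitive M b (1 - ε - η) x := by
  classical
  have hb0 : ∀ i j, 0 ≤ b i j := fun i j => (hb i j).1
  have hx0 : ∀ σ i j, 0 ≤ x σ i j := by
    intro σ i j
    rcases lt_or_ge (j : ℕ) s with hj | hj
    · rw [(hrun σ).explore i j hj]
    · obtain ⟨k, -, hk⟩ := (hrun σ).exploit j hj
      rw [hk i]
      split_ifs
      exacts [zero_le_one, le_rfl]
  set f : Equiv.Perm (Fin n) → ℝ := fun σ => gain M fun i => ∑ j, arrivals b σ i j * x σ i j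
    with hf
  have hf0 : ∀ σ, 0 ≤ f σ := fun σ =>
    gain_nonneg hM fun i => sum_nonneg fun j _ => mul_nonneg (hb0 i (σ j)) (hx0 σ i j)
  have hfac : (0 : ℝ) < n.factorial := by exact_mod_cast n.factorial_pos
  unfold IsCompetitive orderMean
  rw [le_div_iff₀ hfac]
  by_cases h0 : m = 0 ∨ n = 0
  · rw [opt_eq_zero hM hb0 h0, mul_zero, zero_mul]
    exact sum_nonneg fun σ _ => hf0 σ
  push Not at h0
  have hm : 0 < m := Nat.pos_of_ne_zero h0.1
  have hn : 0 < n := Nat.pos_of_ne_zero h0.2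
  obtain ⟨hκ0, hκ1⟩ := hκ
  obtain ⟨hε0, hε1⟩ := hε
  have hk : 0 < 1 - κ := sub_pos.2 hκ1
  set δ : ℝ := κ * ε with hδ
  have hδ0 : 0 < δ := mul_pos hκ0 hε0
  have hδ2 : δ < 1 / 2 := by nlinarith
  have hsn : s ≤ n := by
    have h1 := (abs_lt.1 hs).2
    have hn1 : (1 : ℝ) ≤ n := by exact_mod_cast hn
    by_contra! h
    have h2 : (n : ℝ) + 1 ≤ s := by exact_mod_cast h
    nlinarith
  set L : ℝ := 1600 * (4 + 2 / (1 - κ)) / ((1 - κ) ^ 2 * κ) *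
    (m * Real.log ((m : ℝ) ^ 2 * n / ε) / ε ^ 3) with hL
  set τ : ℝ := (1 - κ) * ε / 20 with hτ
  have hτ0 : 0 < τ := by positivity
  have hτ1 : τ ≤ 1 / 10 := by
    have : (1 - κ) * ε ≤ 1 := by nlinarith
    linarith
  obtain ⟨hB1, hB2⟩ := threshold_bounds ⟨hκ0, hκ1⟩ ⟨hε0, hε1⟩ hm hn hτ (B := δ * L) rfl
  set G : Set (Equiv.Perm (Fin n)) :=
    {σ | (∀ i, L ≤ u σ i) ∧ ∃ i, slope (M i) (u σ i) ≠ 0} with hG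
  set D : Set (Equiv.Perm (Fin n)) := {σ | ∃ (p : Fin m → ℝ) (i : Fin m),
        τ * max (s * (∑ j, clearValue b p i j) / n) (δ * L) <
          |∑ j with (j : Fin n).val < s, clearValue b p i (σ j) -
            s * (∑ j, clearValue b p i j) / n|} with hD
  have hDcard : (D.ncard : ℝ) ≤ n.factorial * ((1 - κ) * ε / 2) :=
    (card_exists_clearValue_deviation_le hsn hn b hb hτ0.le (by linarith)).trans
      (mul_le_mul_of_nonneg_left hB2 hfac.le)
  have hGcard : (1 - η) * n.factorial ≤ G.ncard := by
    rw [orderProb, le_div_iff₀ hfac] at hprob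
    exact hprob
  have hGD : (G.ncard : ℝ) ≤ (G \ D).ncard + D.ncard := by
    exact_mod_cast (Set.ncard_le_ncard (by rw [Set.sdiff_union_self]; exact Set.subset_union_left)
      (Set.toFinite _)).trans (Set.ncard_union_le (G \ D) D)
  have hgood : ∀ σ ∈ G \ D, (1 - δ - 10 * τ) * opt M b ≤ f σ := by
    rintro σ ⟨⟨hσ, hne⟩, hσD⟩
    rw [← opt_arrivals M b σ]
    have hbσ : ∀ i j, arrivals b σ i j ∈ Set.Icc (0 : ℝ) 1 := fun i j => hb i (σ j)
    refine (hrun σ).mul_opt_le_gain hM hbσ (hgp.arrivals σ) hn hδ0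
      (by linarith) hs hτ0 hτ1 hB1 (fun i => mul_le_mul_of_nonneg_left (hσ i) hδ0.le) hne fun i => ?_
    have hperm : ∀ p : Fin m → ℝ, ∑ j, clearValue (arrivals b σ) p i j =
        ∑ j, clearValue b p i j := fun p => Equiv.sum_comp σ fun j => clearValue b p i j
    rw [hperm]
    by_contra! hcon
    exact hσD ⟨_, i, hcon⟩
  have hopt := opt_nonneg hM hb0
  have hc0 : 0 ≤ 1 - δ - 10 * τ := by nlinarith
  have hsum : ((G \ D).ncard : ℝ) * ((1 - δ - 10 * τ) * opt M b) ≤ ∑ σ, f σ := by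
    rw [Set.ncard_eq_toFinset_card', ← nsmul_eq_mul]
    refine (card_nsmul_le_sum _ _ _ fun σ hσ => hgood σ (Set.mem_toFinset.1 hσ)).trans ?_
    exact sum_le_sum_of_subset_of_nonneg (subset_univ _) fun σ _ _ => hf0 σ
  refine le_trans ?_ hsum
  have hcount : (1 - η - (1 - κ) * ε / 2) * n.factorial ≤ ((G \ D).ncard : ℝ) := by linarith
  refine le_trans ?_ (mul_le_mul_of_nonneg_right hcount (mul_nonneg hc0 hopt))
  -- The two losses add up to `ε + η`, and their product only helps.
  have hcoef : 1 - ε - η ≤ (1 - η - (1 - κ) * ε / 2) * (1 - δ - 10 * τ) := by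
    have h1 : 0 ≤ (η + (1 - κ) * ε / 2) * (δ + 10 * τ) := by positivity
    have h2 : 10 * τ = (1 - κ) * ε / 2 := by rw [hτ]; ring
    have h3 : δ + (1 - κ) * ε = ε := by rw [hδ]; ring
    nlinarith
  have := mul_le_mul_of_nonneg_right hcoef (mul_nonneg hopt hfac.le)
  linarith

end OnlineMatching

theorem proposition1 (κ : ℝ) (hκ : κ ∈ Set.Ioo (0 : ℝ) 1) :
    ∃ C : ℝ, 0 < C ∧
      ∀ (ε : ℝ), ε ∈ Set.Ioo (0 : ℝ) (1 / 2) →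
      ∀ (m n s : ℕ), |(s : ℝ) - κ * ε * n| < 1 →
      ∀ (M : Fin m → ℝ → ℝ), (∀ i, OnlineMatching.IsReturn (M i)) →
      ∀ (b : Fin m → Fin n → ℝ), (∀ i j, b i j ∈ Set.Icc (0 : ℝ) 1) →
        OnlineMatching.GeneralPosition b →
      ∀ (u : Equiv.Perm (Fin n) → Fin m → ℝ) (x : Equiv.Perm (Fin n) → Fin m → Fin n → ℝ),
        (∀ σ, OnlineMatching.IsOLARun M (κ * ε) s (OnlineMatching.arrivals b σ) (u σ) (x σ)) →
      ∀ (η : ℝ), 0 ≤ η →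
        1 - η ≤ OnlineMatching.orderProb {σ : Equiv.Perm (Fin n) |
          (∀ i, C * (m * Real.log ((m : ℝ) ^ 2 * n / ε) / ε ^ 3) ≤ u σ i) ∧
          ∃ i, OnlineMatching.slope (M i) (u σ i) ≠ 0} →
        OnlineMatching.IsCompetitive M b (1 - ε - η) x := by
  refine ⟨1600 * (4 + 2 / (1 - κ)) / ((1 - κ) ^ 2 * κ), ?_, ?_⟩
  · have h0 := hκ.1
    have h1 := sub_pos.2 hκ.2
    positivity
  · intro ε hε m n s hs M hM b hb hgp u x hrun η hη hprob
    exact OnlineMatching.isCompetitive_of_threshold hκ hε hs hM hb hgp hrun hη hprob
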